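/- Let $n\ge 1$ and let $M\in \mathrm{SL}(2n+1,\mathbb Z)$ be a matrix of type II, i.e. $M$ has exactly one real eigenvalue $\alpha$, and $\alpha$ is irrational and simple (a simple root of the characteristic polynomial); then automatically $\alpha>0$. Suppose that $M$ is not diagonalizable over $\mathbb C$. The manifold $T_M$ is defined as follows. Let $a=(a^{(1)},\dots,a^{(2n+1)})\in\mathbb R^{2n+1}$ be an eigenvector of $M$ for $\alpha$, let $W\subset\mathbb C^{2n+1}$ be the sum of the generalized eigenspaces of $M$ for the eigenvalues $\beta$ with $\operatorname{Im}\beta>0$, let $b_1,\dots,b_n$ be a basis of $W$, with $b_j=(b_j^{(1)},\dots,b_j^{(2n+1)})$, and let $R=(r_{\ell j})$ be the matrix with $Mb_j=\sum_{\ell} r_{\ell j}b_\ell$. Let $\mathbb H$ be the upper half-plane and let $G_M$ be the group of automorphisms of $\mathbb H\times\mathbb C^n$ generated by $g_0(w,z)=(\alpha w,R^{\top}z)$ and $g_i(w,z)=(w+a^{(i)},\,z+(b_1^{(i)},\dots,b_n^{(i)})^{\top})$ for $1\le i\le 2n+1$. Then $T_M=(\mathbb H\times\mathbb C^n)/G_M$.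 The Oeljeklaus–Toma manifolds $X(K,U)$ are defined as follows. Let $K$ be a number field with real embeddings $\sigma_1,\dots,\sigma_s$ and $t$ conjugate pairs of non-real embeddings, and let $\sigma_{s+1},\dots,\sigma_{s+t}$ be non-real embeddings, one from each pair. Let $\mathcal O_K^{*,+}$ be the group of units $u$ of the ring of integers $\mathcal O_K$ with $\sigma_i(u)>0$ for all $i\le s$. Let $U\subset\mathcal O_K^{*,+}$ be an admissible subgroup, i.e. the map $u\mapsto(\log\sigma_1(u),\dots,\log\sigma_s(u))$ sends $U$ isomorphically onto a full lattice in $\mathbb R^s$. The group $U\ltimes\mathcal O_K$ acts on $\mathbb H^s\times\mathbb C^t$: an element $\xi\in\mathcal O_K$ acts by translation by $(\sigma_1(\xi),\dots,\sigma_{s+t}(\xi))$, and $u\in U$ acts by $(z_1,\dots,z_{s+t})\mapsto(\sigma_1(u)z_1,\dots,\sigma_{s+t}(u)z_{s+t})$. Then $X(K,U)=(\mathbb H^s\times\mathbb C^t)/(U\ltimes\mathcal O_K)$. Then, for all choices of $a$, $b_1,\dots,b_n$, $K$, $U$ and $\sigma_{s+1},\dots,\sigma_{s+t}$ as above, the group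 $\pi_1(T_M)$ is not isomorphic to $\pi_1(X(K,U))$, and $T_M$ is not homeomorphic to $X(K,U)$. -/

import Mathlib

open scoped UpperHalfPlane NumberField Matrix

noncomputable section

namespace GenInoue

/-! ## Orbit spaces of groups of homeomorphisms -/

/-- The tautological action of the homeomorphism group of `X` on `X`. -/
instance homeoAction (X : Type*) [TopologicalSpace X] : MulAction (X ≃ₜ X) X where
  smul f x := f x
  one_smul _ := rfl
  mul_smul _ _ _ := rfl

theorem homeo_smul_def {X : Type*} [TopologicalSpace X] (f : X ≃ₜ X) (x : X) : f • x = f x := rfl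

/-- The orbit space `X / G` of a group `G` of homeomorphisms, with the quotient topology. -/
abbrev OrbitSpace {X : Type*} [TopologicalSpace X] (G : Subgroup (X ≃ₜ X)) : Type _ :=
  MulAction.orbitRel.Quotient G X

/-! ## Matrices of type II and the manifold `T_M` -/

/-- `M` viewed as a real matrix. -/
abbrev realMatrix {n : ℕ} (M : Matrix.SpecialLinearGroup (Fin (2 * n + 1)) ℤ) :
    Matrix (Fin (2 * n + 1)) (Fin (2 * n + 1)) ℝ :=
  (M : Matrix (Fin (2 * n + 1)) (Fin (2 * n + 1)) ℤ).map (Int.castRingHom ℝ)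

/-- `M` viewed as a complex matrix. -/
abbrev complexMatrix {n : ℕ} (M : Matrix.SpecialLinearGroup (Fin (2 * n + 1)) ℤ) :
    Matrix (Fin (2 * n + 1)) (Fin (2 * n + 1)) ℂ :=
  (M : Matrix (Fin (2 * n + 1)) (Fin (2 * n + 1)) ℤ).map (Int.castRingHom ℂ)

/-- `M` has exactly one real eigenvalue; it is simple (the multiset of real roots of the
characteristic polynomial is the singleton `{α}`) and irrational. -/
def IsTypeII {n : ℕ} (M : Matrix.SpecialLinearGroup (Fin (2 * n + 1)) ℤ) : Prop :=
  ∃ α : ℝ, Irrational α ∧ (realMatrix M).charpoly.roots = {α}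

/-- Diagonalizability over `ℂ`. -/
def IsDiagonalizable {n : ℕ} (M : Matrix.SpecialLinearGroup (Fin (2 * n + 1)) ℤ) : Prop :=
  ∃ (P : GL (Fin (2 * n + 1)) ℂ) (d : Fin (2 * n + 1) → ℂ),
    complexMatrix M = P.val * Matrix.diagonal d * P⁻¹.val

/-- The endomorphism of `ℂ^{2n+1}` given by `M`. -/
abbrev complexEnd {n : ℕ} (M : Matrix.SpecialLinearGroup (Fin (2 * n + 1)) ℤ) :
    Module.End ℂ (Fin (2 * n + 1) → ℂ) :=
  Matrix.toLin' (complexMatrix M)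

/-- `W`: the sum of the generalized eigenspaces of `M` for the eigenvalues `β` with `Im β > 0`. -/
def W {n : ℕ} (M : Matrix.SpecialLinearGroup (Fin (2 * n + 1)) ℤ) :
    Submodule ℂ (Fin (2 * n + 1) → ℂ) :=
  ⨆ β : {β : ℂ // 0 < β.im}, (complexEnd M).maxGenEigenspace β.1

theorem mapsTo_W_of_commute {n : ℕ} (M : Matrix.SpecialLinearGroup (Fin (2 * n + 1)) ℤ)
    (g : Module.End ℂ (Fin (2 * n + 1) → ℂ)) (hg : Commute (complexEnd M) g) :
    ∀ x ∈ W M, g x ∈ W M := by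
  intro x hx
  have h : W M ≤ (W M).comap g := by
    refine iSup_le fun β y hy => ?_
    exact Submodule.mem_iSup_of_mem β
      (Module.End.mapsTo_maxGenEigenspace_of_comm hg β.1 hy)
  exact h hx

theorem complexEnd_mul_inv {n : ℕ} (M : Matrix.SpecialLinearGroup (Fin (2 * n + 1)) ℤ) :
    complexEnd M * complexEnd M⁻¹ = 1 := by
  rw [complexEnd, complexEnd, Module.End.mul_eq_comp, ← Matrix.toLin'_mul, complexMatrix,
    complexMatrix, ← Matrix.map_mul, ← Matrix.SpecialLinearGroup.coe_mul, mul_inv_cancel]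
  simp [Module.End.one_eq_id]

/-- The restriction `f_M : W → W` of `M`. -/
def restrictW {n : ℕ} (M : Matrix.SpecialLinearGroup (Fin (2 * n + 1)) ℤ) :
    W M →ₗ[ℂ] W M :=
  (complexEnd M).restrict (mapsTo_W_of_commute M _ (Commute.refl _))

/-- The choices made in the construction of `T_M`: a real eigenvector `a` of `M` (with its
eigenvalue `α`) and a basis `b_1, …, b_n` of `W`. -/
structure Frame {n : ℕ} (M : Matrix.SpecialLinearGroup (Fin (2 * n + 1)) ℤ) where
  α : ℝ
  a : Fin (2 * n + 1) → ℝ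
  a_ne_zero : a ≠ 0
  eigen : realMatrix M *ᵥ a = α • a
  b : Module.Basis (Fin n) ℂ (W M)

namespace Frame

variable {n : ℕ} {M : Matrix.SpecialLinearGroup (Fin (2 * n + 1)) ℤ}

/-- The matrix `R` of `f_M` in the basis `b`: `M b_j = ∑ ℓ, R ℓ j • b_ℓ`. -/
def R (F : Frame M) : Matrix (Fin n) (Fin n) ℂ :=
  LinearMap.toMatrix F.b F.b (restrictW M)

theorem isUnit_R (F : Frame M) : IsUnit F.R := by
  have hc : Commute (complexEnd M) (complexEnd M⁻¹) := by
    have h1 := complexEnd_mul_inv M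
    have h2 := complexEnd_mul_inv M⁻¹
    rw [inv_inv] at h2
    exact h1.trans h2.symm
  let g : W M →ₗ[ℂ] W M := (complexEnd M⁻¹).restrict (mapsTo_W_of_commute M _ hc)
  have hfg : restrictW M ∘ₗ g = LinearMap.id := by
    ext1 x
    apply Subtype.ext
    exact LinearMap.congr_fun (complexEnd_mul_inv M) (x : Fin (2 * n + 1) → ℂ)
  have h : F.R * LinearMap.toMatrix F.b F.b g = 1 := by
    rw [R, ← LinearMap.toMatrix_comp, hfg, LinearMap.toMatrix_id]
  exact IsUnit.of_mul_eq_one _ h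

theorem α_pos (F : Frame M) (hM : IsTypeII M) : 0 < F.α := by
  obtain ⟨α', -, hroots⟩ := hM
  have hmonic := (realMatrix M).charpoly_monic
  have key : ∀ x : ℝ, (realMatrix M).charpoly.IsRoot x ↔ x = α' := fun x => by
    rw [← Polynomial.mem_roots hmonic.ne_zero, hroots, Multiset.mem_singleton]
  have hα : F.α = α' := by
    rw [← key, ← Matrix.mem_spectrum_iff_isRoot_charpoly, ← Matrix.spectrum_toLin',
      ← Module.End.hasEigenvalue_iff_mem_spectrum]
    refine Module.End.hasEigenvalue_of_hasEigenvector (x := F.a) ⟨?_, F.a_ne_zero⟩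
    rw [Module.End.mem_eigenspace_iff, Matrix.toLin'_apply, F.eigen]
  have h0 : (realMatrix M).charpoly.eval 0 = -1 := by
    have hdet : (realMatrix M).det = 1 := by
      have h := (Int.castRingHom ℝ).map_det
        (M : Matrix (Fin (2 * n + 1)) (Fin (2 * n + 1)) ℤ)
      rw [M.det_coe, map_one] at h
      exact h.symm
    rw [Matrix.eval_charpoly, map_zero, zero_sub, Matrix.det_neg, hdet]
    simp [pow_succ]
  have hdeg : 0 < (realMatrix M).charpoly.degree := by
    rw [Matrix.charpoly_degree_eq_dim, Fintype.card_fin]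
    exact_mod_cast Nat.succ_pos _
  have ht := Polynomial.tendsto_atTop_of_leadingCoeff_nonneg (realMatrix M).charpoly hdeg
    (by rw [hmonic.leadingCoeff]; exact zero_le_one)
  obtain ⟨y, hy0, hy⟩ := ((Filter.eventually_ge_atTop (0 : ℝ)).and
    (ht.eventually_ge_atTop 0)).exists
  obtain ⟨x, hx, hx0⟩ := intermediate_value_Icc hy0
    ((realMatrix M).charpoly.continuous.continuousOn) (show (0 : ℝ) ∈ _ from ⟨by simp [h0], hy⟩)
  have hxα : x = α' := (key x).1 hx0
  rw [hα, ← hxα]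
  refine lt_of_le_of_ne hx.1 fun h => ?_
  rw [← h] at hx0
  simp only [h0] at hx0
  norm_num at hx0

/-- `g₀(w, z) = (α w, Rᵀ z)`. -/
def g₀ (F : Frame M) (hM : IsTypeII M) : (ℍ × (Fin n → ℂ)) ≃ₜ (ℍ × (Fin n → ℂ)) where
  toFun p := ((⟨F.α, F.α_pos hM⟩ : {x : ℝ // 0 < x}) • p.1, F.Rᵀ *ᵥ p.2)
  invFun p := ((⟨F.α, F.α_pos hM⟩ : {x : ℝ // 0 < x})⁻¹ • p.1, (F.Rᵀ)⁻¹ *ᵥ p.2)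
  left_inv p := by
    have hu : IsUnit (F.Rᵀ).det := by
      rw [Matrix.det_transpose]; exact (Matrix.isUnit_iff_isUnit_det _).1 F.isUnit_R
    ext1
    · exact inv_smul_smul _ _
    · simp [Matrix.mulVec_mulVec, Matrix.nonsing_inv_mul _ hu]
  right_inv p := by
    have hu : IsUnit (F.Rᵀ).det := by
      rw [Matrix.det_transpose]; exact (Matrix.isUnit_iff_isUnit_det _).1 F.isUnit_R
    ext1
    · exact smul_inv_smul _ _
    · simp [Matrix.mulVec_mulVec, Matrix.mul_nonsing_inv _ hu]
  continuous_toFun :=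
    ((UpperHalfPlane.isometry_pos_mul _).continuous.comp continuous_fst).prodMk
      (continuous_const.matrix_mulVec continuous_snd)
  continuous_invFun :=
    ((UpperHalfPlane.isometry_pos_mul _).continuous.comp continuous_fst).prodMk
      (continuous_const.matrix_mulVec continuous_snd)

/-- `g_i(w, z) = (w, z) + u_i` with `u_i = (a^{(i)}, b_1^{(i)}, …, b_n^{(i)})`. -/
def g (F : Frame M) (i : Fin (2 * n + 1)) :
    (ℍ × (Fin n → ℂ)) ≃ₜ (ℍ × (Fin n → ℂ)) where
  toFun p := (F.a i +ᵥ p.1, fun j => p.2 j + (F.b j : Fin (2 * n + 1) → ℂ) i)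
  invFun p := (-F.a i +ᵥ p.1, fun j => p.2 j - (F.b j : Fin (2 * n + 1) → ℂ) i)
  left_inv p := by
    ext1
    · exact neg_vadd_vadd _ _
    · funext j; simp
  right_inv p := by
    ext1
    · exact vadd_neg_vadd _ _
    · funext j; simp
  continuous_toFun :=
    ((UpperHalfPlane.isometry_real_vadd _).continuous.comp continuous_fst).prodMk (by fun_prop)
  continuous_invFun :=
    ((UpperHalfPlane.isometry_real_vadd _).continuous.comp continuous_fst).prodMk (by fun_prop)

/-- The group `G_M` generated by `g₀, g_1, …, g_{2n+1}`. -/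
def group (F : Frame M) (hM : IsTypeII M) :
    Subgroup ((ℍ × (Fin n → ℂ)) ≃ₜ (ℍ × (Fin n → ℂ))) :=
  Subgroup.closure (insert (F.g₀ hM) (Set.range F.g))

/-- (The underlying topological space of) the manifold `T_M = (ℍ × ℂⁿ) / G_M`. -/
abbrev T (F : Frame M) (hM : IsTypeII M) : Type :=
  OrbitSpace (F.group hM)

end Frame

/-! ## Oeljeklaus–Toma manifolds -/

section OT

open NumberField

variable (K : Type*) [Field K] [NumberField K]

/-- The `s` real embeddings of `K`. -/
abbrev RealPlace : Type _ := {w : InfinitePlace K // w.IsReal}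

/-- The `t` conjugate pairs of non-real embeddings of `K`. -/
abbrev ComplexPlace : Type _ := {w : InfinitePlace K // w.IsComplex}

variable {K} in
/-- The real embedding attached to a real place. -/
def realEmb (w : RealPlace K) : K →+* ℝ := InfinitePlace.embedding_of_isReal w.2

/-- The group of units of `𝓞 K` that are positive in every real embedding. -/
def positiveUnits : Subgroup (𝓞 K)ˣ where
  carrier := {u | ∀ w : RealPlace K, 0 < realEmb w (u : 𝓞 K)}
  one_mem' w := by simp
  mul_mem' {u v} hu hv w := by simpa using mul_pos (hu w) (hv w)
  inv_mem' {u} hu w := by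
    have h : realEmb w ((u : 𝓞 K) : K) * realEmb w (((u⁻¹ : (𝓞 K)ˣ) : 𝓞 K) : K) = 1 := by
      rw [← map_mul, ← map_mul, Units.mul_inv, map_one, map_one]
    exact pos_of_mul_pos_right (by rw [h]; exact one_pos) (hu w).le

variable {K}

/-- The logarithmic map `u ↦ (log σ_1(u), …, log σ_s(u))` on positive units. -/
def logReal : Additive (positiveUnits K) →+ (RealPlace K → ℝ) where
  toFun u w := Real.log (realEmb w ((u.toMul : (𝓞 K)ˣ) : 𝓞 K))
  map_zero' := by funext w; simp
  map_add' u v := by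
    funext w
    simpa using Real.log_mul (u.toMul.2 w).ne' (v.toMul.2 w).ne'

/-- The image of `U` in `ℝ^s` under the logarithmic map. -/
def logImage (U : Subgroup (positiveUnits K)) : Submodule ℤ (RealPlace K → ℝ) :=
  AddSubgroup.toIntSubmodule (U.toAddSubgroup.map logReal)

/-- `U` is admissible: the logarithmic map carries `U` isomorphically onto a full lattice in
`ℝ^s`; in particular `U` is free abelian of rank `s`. -/
structure IsAdmissible (U : Subgroup (positiveUnits K)) : Prop where
  injOn : ∀ u ∈ U, logReal (Additive.ofMul u) = 0 → u = 1
  discrete : DiscreteTopology (logImage U)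
  span_eq_top : Submodule.span ℝ (logImage U : Set (RealPlace K → ℝ)) = ⊤

variable (K) in
/-- The space `ℍ^s × ℂ^t`. -/
abbrev OTSpace : Type _ := (RealPlace K → ℍ) × (ComplexPlace K → ℂ)

/-- Translation by `σ(ξ) ∈ ℝ^s × ℂ^t`, where `τ` consists of one embedding from each
conjugate pair of non-real embeddings. -/
def otTranslation (τ : ComplexPlace K → K →+* ℂ) (ξ : 𝓞 K) : OTSpace K ≃ₜ OTSpace K where
  toFun p := (fun w => realEmb w ξ +ᵥ p.1 w, fun w => p.2 w + τ w ξ)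
  invFun p := (fun w => -realEmb w ξ +ᵥ p.1 w, fun w => p.2 w - τ w ξ)
  left_inv p := by
    ext1
    · funext w; exact neg_vadd_vadd _ _
    · funext w; simp
  right_inv p := by
    ext1
    · funext w; exact vadd_neg_vadd _ _
    · funext w; simp
  continuous_toFun := Continuous.prodMk
    (continuous_pi fun w => (UpperHalfPlane.isometry_real_vadd _).continuous.comp
      ((continuous_apply w).comp continuous_fst)) (by fun_prop)
  continuous_invFun := Continuous.prodMk
    (continuous_pi fun w => (UpperHalfPlane.isometry_real_vadd _).continuous.comp
      ((continuous_apply w).comp continuous_fst)) (by fun_prop)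

/-- The positive real number `σ_w(u)`. -/
def posReal (u : positiveUnits K) (w : RealPlace K) : {x : ℝ // 0 < x} :=
  ⟨realEmb w ((u : (𝓞 K)ˣ) : 𝓞 K), u.2 w⟩

/-- `u · (z_1, …, z_{s+t}) = (σ_1(u) z_1, …, σ_{s+t}(u) z_{s+t})`. -/
def otDilation (τ : ComplexPlace K → K →+* ℂ) (u : positiveUnits K) :
    OTSpace K ≃ₜ OTSpace K where
  toFun p := (fun w => posReal u w • p.1 w, fun w => τ w ((u : (𝓞 K)ˣ) : 𝓞 K) * p.2 w)
  invFun p := (fun w => (posReal u w)⁻¹ • p.1 w,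
    fun w => (τ w ((u : (𝓞 K)ˣ) : 𝓞 K))⁻¹ * p.2 w)
  left_inv p := by
    ext1
    · funext w; exact inv_smul_smul _ _
    · funext w; simp
  right_inv p := by
    ext1
    · funext w; exact smul_inv_smul _ _
    · funext w; simp
  continuous_toFun := Continuous.prodMk
    (continuous_pi fun w => (UpperHalfPlane.isometry_pos_mul _).continuous.comp
      ((continuous_apply w).comp continuous_fst)) (by fun_prop)
  continuous_invFun := Continuous.prodMk
    (continuous_pi fun w => (UpperHalfPlane.isometry_pos_mul _).continuous.comp
      ((continuous_apply w).comp continuous_fst)) (by fun_prop)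

/-- Multiplication of `U` on `𝓞 K` by group automorphisms. -/
def otMul (U : Subgroup (positiveUnits K)) : U →* MulAut (Multiplicative (𝓞 K)) where
  toFun u := AddEquiv.toMultiplicative
    (DistribMulAction.toAddEquiv (𝓞 K) ((u : positiveUnits K) : (𝓞 K)ˣ))
  map_one' := by ext x; simp
  map_mul' u v := by
    refine MulEquiv.ext fun x => ?_
    exact congrArg (fun y : 𝓞 K => Multiplicative.ofAdd y) (mul_smul
      ((u : positiveUnits K) : (𝓞 K)ˣ) ((v : positiveUnits K) : (𝓞 K)ˣ) x.toAdd)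

/-- The action of the semidirect product `U ⋉ 𝓞 K` on `ℍ^s × ℂ^t`: `𝓞 K` acts by translations,
`U` by coordinatewise multiplication. -/
def otAction (τ : ComplexPlace K → K →+* ℂ) (U : Subgroup (positiveUnits K)) :
    Multiplicative (𝓞 K) ⋊[otMul U] U →* (OTSpace K ≃ₜ OTSpace K) :=
  SemidirectProduct.lift
    { toFun := fun ξ => otTranslation τ ξ.toAdd
      map_one' := by
        ext1 p
        ext1
        · funext w; simp [otTranslation]
        · funext w; simp [otTranslation]
      map_mul' := fun ξ η => by
        ext1 p
        ext1
        · funext w; simp [otTranslation, add_vadd]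
        · funext w; simp [otTranslation]; ring }
    { toFun := fun u => otDilation τ u
      map_one' := by
        ext1 p
        ext1
        · funext w
          have : posReal (1 : positiveUnits K) w = 1 := Subtype.ext (by simp [posReal])
          simp [otDilation, this]
        · funext w; simp [otDilation]
      map_mul' := fun u v => by
        ext1 p
        ext1
        · funext w
          have : posReal (u.1 * v.1) w = posReal u.1 w * posReal v.1 w :=
            Subtype.ext (by simp [posReal])
          simp [otDilation, this, mul_smul]
        · funext w; simp [otDilation]; ring }
    (by
      intro u
      refine MonoidHom.ext fun ξ => ?_
      simp only [MonoidHom.comp_apply, MulEquiv.coe_toMonoidHom, MulAut.conj_apply]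
      rw [eq_mul_inv_iff_mul_eq]
      ext1 p
      ext1
      · funext w
        apply UpperHalfPlane.ext
        simp [otMul, otTranslation, otDilation, posReal, Units.smul_def, mul_add]
      · funext w
        simp [otMul, otTranslation, otDilation, Units.smul_def]; ring)

/-- (The underlying topological space of) the Oeljeklaus–Toma manifold
`X(K, U) = (ℍ^s × ℂ^t) / (U ⋉ 𝓞 K)`. -/
abbrev OTManifold (τ : ComplexPlace K → K →+* ℂ) (U : Subgroup (positiveUnits K)) : Type _ :=
  OrbitSpace (otAction τ U).range

end OT

end GenInoue

end

open scoped UpperHalfPlane NumberField Matrix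

noncomputable section

namespace GenInoue

/-! ## Diagonalizability from a separable annihilating polynomial -/

/-! Both manifolds are quotients of contractible spaces by groups acting as covering groups, so
their fundamental groups are `G_M` and `U ⋉ 𝓞 K`, and it suffices to distinguish these groups.

In `U ⋉ 𝓞 K` every commutator lies in `𝓞 K`, and conjugation acts on `𝓞 K` as multiplication by a
unit `u`. In `G_M`, conjugation by `g₀` acts on the translation lattice `ℤ^{2n+1}` by `Mᵀ`. Since
`1` is not an eigenvalue of `M`, `Mᵀ - 1` is injective, and its image consists of commutators. An
embedding of `G_M` into `U ⋉ 𝓞 K` therefore embeds the lattice into `𝓞 K` so that `Mᵀ` becomes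
multiplication by `u` (`exists_aeval_minpoly_eq_zero`). Then the minimal polynomial of `u`, which is
separable, annihilates `M`, so `M` is diagonalizable, a contradiction.

The covering property rests on discreteness: of the periods of `T_M` (`period_injective`), and of `𝓞
K` and the logarithms of `U` on the other side. -/

theorem exists_eq_mul_diagonal_mul_inv {m : ℕ} (A : Matrix (Fin m) (Fin m) ℂ)
    (p : Polynomial ℂ) (hp : p.Separable) (hA : Polynomial.aeval A p = 0) :
    ∃ (P : GL (Fin m) ℂ) (d : Fin m → ℂ), A = P.val * Matrix.diagonal d * P⁻¹.val := by
  set f : Module.End ℂ (Fin m → ℂ) := Matrix.toLin' A with hf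
  have hfp : Polynomial.aeval f p = 0 := by
    have h := Polynomial.aeval_algHom_apply
      (Matrix.toLinAlgEquiv' : Matrix (Fin m) (Fin m) ℂ ≃ₐ[ℂ] _).toAlgHom A p
    rw [hA, map_zero] at h
    exact h
  -- A squarefree annihilating polynomial makes `f` semisimple, so over `ℂ` its eigenvectors span
  -- and a basis can be extracted from them.
  have htop := (Module.End.isSemisimple_of_squarefree_aeval_eq_zero hp.squarefree
    hfp).iSup_eigenspace_eq_top
  set s : Set (Fin m → ℂ) := {x | ∃ μ : ℂ, f x = μ • x} with hs
  have hspan : ⊤ ≤ Submodule.span ℂ s := by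
    rw [← htop]
    exact iSup_le fun μ x hx =>
      Submodule.subset_span ⟨μ, Module.End.mem_eigenspace_iff.1 hx⟩
  let b₀ := Module.Basis.ofSpan hspan
  let e := b₀.indexEquiv (Pi.basisFun ℂ (Fin m))
  let b := b₀.reindex e
  have hb : ∀ i, ∃ μ : ℂ, f (b i) = μ • b i := fun i => by
    have : b₀ (e.symm i) ∈ s := Module.Basis.ofSpan_subset hspan ⟨_, rfl⟩
    obtain ⟨μ, hμ⟩ := this
    exact ⟨μ, by simpa only [b, Module.Basis.reindex_apply] using hμ⟩
  choose d hd using hb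
  let Q := (Pi.basisFun ℂ (Fin m)).toMatrix b
  have hQ : Q * b.toMatrix (Pi.basisFun ℂ (Fin m)) = 1 :=
    Module.Basis.toMatrix_mul_toMatrix_flip _ _
  have hQ' : b.toMatrix (Pi.basisFun ℂ (Fin m)) * Q = 1 :=
    Module.Basis.toMatrix_mul_toMatrix_flip _ _
  refine ⟨⟨Q, b.toMatrix (Pi.basisFun ℂ (Fin m)), hQ, hQ'⟩, d, ?_⟩
  change A = Q * Matrix.diagonal d * b.toMatrix (Pi.basisFun ℂ (Fin m))
  have key : A * Q = Q * Matrix.diagonal d := by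
    ext i j
    rw [Matrix.mul_diagonal]
    have h := congrFun (hd j) i
    simpa [f, Q, Matrix.mul_apply, Module.Basis.toMatrix_apply, Matrix.mulVec, dotProduct,
      mul_comm] using h
  rw [← key, Matrix.mul_assoc, hQ, Matrix.mul_one]

/-! ## Homomorphisms into `U ⋉ 𝓞 K` -/

section Groups

variable {K : Type*} [Field K]

/-- The quotient by `𝓞 K` is `U`, which is abelian. -/
theorem right_commutator_eq_one {U : Subgroup (positiveUnits K)}
    (x y : Multiplicative (𝓞 K) ⋊[otMul U] U) : (x * y * x⁻¹ * y⁻¹).right = 1 := by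
  simp

/-- As `𝓞 K` is commutative, the translation part of `x` cancels and only its unit part acts. -/
theorem left_conj_of_right_eq_one {U : Subgroup (positiveUnits K)}
    (x y : Multiplicative (𝓞 K) ⋊[otMul U] U) (hy : y.right = 1) :
    (x * y * x⁻¹).left = otMul U x.right y.left := by
  simp only [SemidirectProduct.mul_left, SemidirectProduct.mul_right, hy, mul_one,
    SemidirectProduct.inv_left, map_inv, MulAut.apply_inv_self]
  rw [mul_comm x.left, mul_inv_cancel_right]

/-- If `ℤᵐ` embeds into a group `G` in such a way that an element of `G` acts on it by conjugation
through a matrix `A` without the eigenvalue `1`, and `G` embeds into `U ⋉ 𝓞 K`, then `A` is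
annihilated by the minimal polynomial of a unit of `K`. -/
theorem exists_aeval_minpoly_eq_zero [NumberField K] {U : Subgroup (positiveUnits K)} {G : Type*} [Group G]
    {m : ℕ} (h : Multiplicative (Fin m → ℤ) →* G) (hinj : Function.Injective h)
    (g : G) (A : Matrix (Fin m) (Fin m) ℤ) (hdet : (A - 1).det ≠ 0)
    (hconj : ∀ v, g * h (Multiplicative.ofAdd v) * g⁻¹ = h (Multiplicative.ofAdd (A *ᵥ v)))
    (φ : G →* Multiplicative (𝓞 K) ⋊[otMul U] U) (hφ : Function.Injective φ) :
    ∃ u : 𝓞 K, Polynomial.aeval A (minpoly ℤ u) = 0 := by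
  -- Inserting `A - 1` turns the image of `v` into the commutator of `φ g` and `φ (h v)`, which
  -- forces it into `𝓞 K`.
  let c : (Fin m → ℤ) → Multiplicative (𝓞 K) ⋊[otMul U] U :=
    fun v => φ (h (Multiplicative.ofAdd ((A - 1) *ᵥ v)))
  have hc : ∀ v, (c v).right = 1 := fun v => by
    have : c v = φ g * φ (h (Multiplicative.ofAdd v)) * (φ g)⁻¹ *
        (φ (h (Multiplicative.ofAdd v)))⁻¹ := by
      simp only [← map_mul, ← map_inv, hconj, c]
      rw [← ofAdd_neg, ← ofAdd_add, Matrix.sub_mulVec, Matrix.one_mulVec, sub_eq_add_neg]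
    rw [this, right_commutator_eq_one]
  have cadd : ∀ v w, c (v + w) = c v * c w := fun v w => by
    simp only [c, Matrix.mulVec_add, ofAdd_add, map_mul]
  let ψ : (Fin m → ℤ) →+ 𝓞 K := AddMonoidHom.mk' (fun v => (c v).left.toAdd) fun v w => by
    simp [cadd, SemidirectProduct.mul_left, hc]
  have hψ : ∀ v, ψ v = 0 → v = 0 := fun v hv => by
    have h1 : c v = 1 := SemidirectProduct.ext (by simpa [ψ] using hv) (hc v)
    have h2 : (A - 1) *ᵥ v = 0 := by
      have := hinj (hφ ((h1.trans (map_one φ).symm).trans (congrArg φ (map_one h).symm)))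
      simpa using this
    exact Matrix.eq_zero_of_mulVec_eq_zero hdet h2
  -- `ψ` intertwines `A` with multiplication by this unit, because `A` commutes with `A - 1`.
  let u : 𝓞 K := (((φ g).right : positiveUnits K) : (𝓞 K)ˣ)
  have hu : ∀ v, ψ (A *ᵥ v) = u * ψ v := fun v => by
    have h1 : c (A *ᵥ v) = φ g * c v * (φ g)⁻¹ := by
      simp only [c, ← map_mul, ← map_inv, hconj, Matrix.mulVec_mulVec]
      rw [Matrix.sub_mul, Matrix.mul_sub, Matrix.one_mul, Matrix.mul_one]
    change (c (A *ᵥ v)).left.toAdd = _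
    rw [h1, left_conj_of_right_eq_one _ _ (hc v)]
    rfl
  have hp : ∀ (p : Polynomial ℤ) v, ψ (Polynomial.aeval A p *ᵥ v) = Polynomial.aeval u p * ψ v := by
    intro p
    induction p using Polynomial.induction_on' with
    | add p q hp hq => intro v; simp [Matrix.add_mulVec, hp, hq, add_mul]
    | monomial k a =>
      have hk : ∀ (k : ℕ) v, ψ (A ^ k *ᵥ v) = u ^ k * ψ v := fun k => by
        induction k with
        | zero => simp
        | succ k ih => intro v; rw [pow_succ, ← Matrix.mulVec_mulVec, ih, hu, pow_succ, mul_assoc]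
      intro v
      rw [Polynomial.aeval_monomial, Polynomial.aeval_monomial, ← Matrix.mulVec_mulVec,
        eq_intCast (algebraMap ℤ (𝓞 K)), eq_intCast (algebraMap ℤ (Matrix (Fin m) (Fin m) ℤ))]
      have : ((a : Matrix (Fin m) (Fin m) ℤ)) *ᵥ (A ^ k *ᵥ v) = a • (A ^ k *ᵥ v) := by
        rw [← zsmul_one, Matrix.smul_mulVec, Matrix.one_mulVec]
      rw [this, map_zsmul, hk, zsmul_eq_mul, mul_assoc]
  refine ⟨u, ?_⟩
  refine Matrix.ext_of_mulVec_single fun i => ?_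
  rw [Matrix.zero_mulVec]
  exact hψ _ (by rw [hp, minpoly.aeval, zero_mul])

/-- `ℤ` is integrally closed, so this is also the minimal polynomial over `ℚ`: irreducible in
characteristic zero, hence separable, and separability survives extension to `ℂ`. -/
theorem separable_minpoly_map [NumberField K] (u : 𝓞 K) :
    ((minpoly ℤ u).map (Int.castRingHom ℂ)).Separable := by
  have hu : IsIntegral ℤ u := Algebra.IsIntegral.isIntegral u
  have h := minpoly.isIntegrallyClosed_eq_field_fractions ℚ K hu
  have hsep : ((minpoly ℤ u).map (algebraMap ℤ ℚ)).Separable := by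
    rw [← h]
    exact (minpoly.irreducible (Algebra.IsIntegral.isIntegral _)).separable
  have := hsep.map (f := algebraMap ℚ ℂ)
  rwa [Polynomial.map_map, Subsingleton.elim ((algebraMap ℚ ℂ).comp (algebraMap ℤ ℚ))
    (Int.castRingHom ℂ)] at this

end Groups

theorem isDiagonalizable_of_aeval_transpose {n : ℕ}
    (M : Matrix.SpecialLinearGroup (Fin (2 * n + 1)) ℤ) (p : Polynomial ℤ)
    (hp : (p.map (Int.castRingHom ℂ)).Separable)
    (h : Polynomial.aeval (M : Matrix (Fin (2 * n + 1)) (Fin (2 * n + 1)) ℤ)ᵀ p = 0) :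
    IsDiagonalizable M := by
  refine exists_eq_mul_diagonal_mul_inv _ _ hp ?_
  have h1 : Polynomial.aeval (M : Matrix (Fin (2 * n + 1)) (Fin (2 * n + 1)) ℤ) p = 0 := by
    rw [Polynomial.aeval_eq_sum_range] at h ⊢
    simpa only [Matrix.transpose_sum, Matrix.transpose_smul, Matrix.transpose_pow,
      Matrix.transpose_transpose, Matrix.transpose_zero] using congrArg Matrix.transpose h
  have h5 := Polynomial.aeval_algHom_apply (Int.castRingHom ℂ).mapMatrix.toIntAlgHom
    (M : Matrix (Fin (2 * n + 1)) (Fin (2 * n + 1)) ℤ) p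
  rw [h1, map_zero] at h5
  rw [← algebraMap_int_eq, Polynomial.aeval_map_algebraMap]
  exact h5

/-! ## Fundamental groups of orbit spaces -/

section Covering

open Topology

variable {X : Type*} [TopologicalSpace X]

/-- The hypothesis `hG` encodes both freeness and the disjointness of the translates of `V`. -/
theorem isQuotientCoveringMap_orbitSpace (G : Subgroup (X ≃ₜ X))
    (hG : ∀ p₀ : X, ∃ V ∈ 𝓝 p₀, ∀ f ∈ G, ∀ p ∈ V, f p ∈ V → f = 1) :
    IsQuotientCoveringMap (fun p : X => (Quotient.mk (MulAction.orbitRel G X) p : OrbitSpace G))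
      G where
  toIsQuotientMap := isQuotientMap_quotient_mk'
  continuous_const_smul g := (g : X ≃ₜ X).continuous
  apply_eq_iff_mem_orbit := Quotient.eq''
  disjoint p₀ := by
    obtain ⟨V, hV, h⟩ := hG p₀
    refine ⟨V, hV, fun g hg => ?_⟩
    obtain ⟨_, ⟨p, hp, rfl⟩, hq⟩ := hg
    exact Subtype.ext (h g g.2 p hp hq)

/-- The fundamental group of the base of a simply connected quotient covering. -/
theorem nonempty_fundamentalGroup_mulEquiv [SimplyConnectedSpace X] {Y : Type*}
    [TopologicalSpace Y] {G : Type*} [Group G] [MulAction G X] {q : X → Y}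
    (hq : IsQuotientCoveringMap q G) (y : Y) : Nonempty (FundamentalGroup Y y ≃* G) := by
  obtain ⟨p, rfl⟩ := hq.surjective y
  -- The equivalence lands in the opposite group; inversion identifies it with `G`.
  exact ⟨(hq.fundamentalGroupEquiv ⟨p, rfl⟩).trans (MulEquiv.inv' G).symm⟩

end Covering

/-! ## The group `G_M` -/

section Conj

variable {n : ℕ} (M : Matrix.SpecialLinearGroup (Fin (2 * n + 1)) ℤ)

theorem star_complexMatrix_mulVec (x : Fin (2 * n + 1) → ℂ) :
    star (complexMatrix M *ᵥ x) = complexMatrix M *ᵥ star x := by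
  ext i
  simp [Matrix.mulVec, dotProduct]

/-- `M` is real, so conjugation carries the eigenvalues in the lower half-plane to those that `W`
controls. -/
theorem star_mem_maxGenEigenspace {β : ℂ} {x : Fin (2 * n + 1) → ℂ}
    (hx : x ∈ (complexEnd M).maxGenEigenspace β) :
    star x ∈ (complexEnd M).maxGenEigenspace (star β) := by
  rw [Module.End.mem_maxGenEigenspace] at hx ⊢
  obtain ⟨k, hk⟩ := hx
  refine ⟨k, ?_⟩
  have key : ∀ (k : ℕ) (y : Fin (2 * n + 1) → ℂ),
      ((complexEnd M - star β • (1 : Module.End ℂ (Fin (2 * n + 1) → ℂ))) ^ k) (star y) =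
        star (((complexEnd M - β • (1 : Module.End ℂ (Fin (2 * n + 1) → ℂ))) ^ k) y) := by
    intro k
    induction k with
    | zero => intro y; simp
    | succ k ih =>
      intro y
      rw [pow_succ, pow_succ, Module.End.mul_apply, Module.End.mul_apply, ← ih]
      congr 1
      simp [complexEnd, star_complexMatrix_mulVec, star_smul]
  rw [key, hk, star_zero]

/-- Both sides are the algebraic multiplicity of `r`, which does not change from `ℝ` to `ℂ`. -/
theorem finrank_maxGenEigenspace_ofReal (r : ℝ) :
    Module.finrank ℂ ((complexEnd M).maxGenEigenspace (r : ℂ)) =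
      (realMatrix M).charpoly.roots.count r := by
  have h : complexMatrix M = (realMatrix M).map Complex.ofRealHom := by
    ext i j; simp
  rw [LinearMap.finrank_maxGenEigenspace_eq, Polynomial.count_roots, complexEnd,
    Matrix.charpoly_toLin', h, Matrix.charpoly_map (realMatrix M)]
  exact (Polynomial.eq_rootMultiplicity_map Complex.ofRealHom.injective r).symm

end Conj

namespace Frame

variable {n : ℕ} {M : Matrix.SpecialLinearGroup (Fin (2 * n + 1)) ℤ}

/-! ### Spectral consequences of type II and the period map -/

theorem roots_charpoly (F : Frame M) (hM : IsTypeII M) :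
    (realMatrix M).charpoly.roots = {F.α} := by
  obtain ⟨α', -, hroots⟩ := hM
  have : F.α ∈ (realMatrix M).charpoly.roots := by
    rw [Polynomial.mem_roots (realMatrix M).charpoly_monic.ne_zero,
      ← Matrix.mem_spectrum_iff_isRoot_charpoly, ← Matrix.spectrum_toLin',
      ← Module.End.hasEigenvalue_iff_mem_spectrum]
    refine Module.End.hasEigenvalue_of_hasEigenvector (x := F.a) ⟨?_, F.a_ne_zero⟩
    rw [Module.End.mem_eigenspace_iff, Matrix.toLin'_apply, F.eigen]
  rw [hroots, Multiset.mem_singleton] at this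
  rw [hroots, this]

theorem irrational_α (F : Frame M) (hM : IsTypeII M) : Irrational F.α := by
  have h := F.roots_charpoly hM
  obtain ⟨α', hα', hroots⟩ := hM
  rw [hroots, Multiset.singleton_inj] at h
  rwa [← h]

/-- An eigenvalue `1` would be the only real one, `α`, which is irrational. -/
theorem det_transpose_sub_one_ne_zero (F : Frame M) (hM : IsTypeII M) :
    ((M : Matrix (Fin (2 * n + 1)) (Fin (2 * n + 1)) ℤ)ᵀ - 1).det ≠ 0 := by
  intro h
  have h1 : (realMatrix M).charpoly.eval 1 = 0 := by
    rw [Matrix.eval_charpoly, map_one, ← neg_sub, Matrix.det_neg, ← Matrix.det_transpose,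
      Matrix.transpose_sub, Matrix.transpose_one]
    have h2 := congrArg (Int.castRingHom ℝ) h
    rw [RingHom.map_det, map_zero, map_sub, map_one] at h2
    exact mul_eq_zero_of_right _ h2
  have h3 : (1 : ℝ) ∈ (realMatrix M).charpoly.roots :=
    (Polynomial.mem_roots (realMatrix M).charpoly_monic.ne_zero).2 h1
  rw [F.roots_charpoly hM, Multiset.mem_singleton] at h3
  exact (F.irrational_α hM).ne_one h3.symm

theorem mulVec_b (F : Frame M) (j : Fin n) :
    complexMatrix M *ᵥ (F.b j : Fin (2 * n + 1) → ℂ) =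
      ∑ l, F.R l j • (F.b l : Fin (2 * n + 1) → ℂ) := by
  have h := congrArg (Subtype.val) (F.b.sum_repr (restrictW M (F.b j)))
  simp only [AddSubmonoidClass.coe_finsetSum, Submodule.coe_smul] at h
  simp only [R, LinearMap.toMatrix_apply]
  rw [h]
  rfl

/-- The real linear map `v ↦ ∑ i, v i • u_i`, where `u_i = (a^{(i)}, b_1^{(i)}, …, b_n^{(i)})`. -/
def period (F : Frame M) : (Fin (2 * n + 1) → ℝ) →ₗ[ℝ] ℝ × (Fin n → ℂ) where
  toFun v := (v ⬝ᵥ F.a, fun j => (fun i => (v i : ℂ)) ⬝ᵥ (F.b j : Fin (2 * n + 1) → ℂ))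
  map_add' v w := by
    ext1
    · simp
    · funext j
      simp [dotProduct, add_mul, Finset.sum_add_distrib]
  map_smul' c v := by
    ext1
    · simp
    · funext j
      simp [dotProduct, mul_assoc, Finset.mul_sum]

theorem dotProduct_eq_zero_of_mem_W (F : Frame M) {y : Fin (2 * n + 1) → ℂ}
    (hy : ∀ j, y ⬝ᵥ (F.b j : Fin (2 * n + 1) → ℂ) = 0) {x : Fin (2 * n + 1) → ℂ}
    (hx : x ∈ W M) : y ⬝ᵥ x = 0 := by
  have h := congrArg (Subtype.val) (F.b.sum_repr ⟨x, hx⟩)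
  simp only [AddSubmonoidClass.coe_finsetSum, Submodule.coe_smul] at h
  rw [← h, dotProduct_sum]
  exact Finset.sum_eq_zero fun j _ => by rw [dotProduct_smul, hy, smul_zero]

/-- A real vector orthogonal to `a` and to `W` is, by conjugation, orthogonal to every generalized
eigenspace of `M`; these span `ℂ^{2n+1}`, so it vanishes. -/
theorem period_injective (F : Frame M) (hM : IsTypeII M) : Function.Injective F.period := by
  rw [injective_iff_map_eq_zero]
  intro v hv
  have hva : v ⬝ᵥ F.a = 0 := congrArg Prod.fst hv
  set y : Fin (2 * n + 1) → ℂ := fun i => (v i : ℂ) with hy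
  have hvb : ∀ j, y ⬝ᵥ (F.b j : Fin (2 * n + 1) → ℂ) = 0 := fun j =>
    congrFun (congrArg Prod.snd hv) j
  have hystar : star y = y := by ext i; simp [y]
  let ℓ : (Fin (2 * n + 1) → ℂ) →ₗ[ℂ] ℂ := dotProductBilin ℂ ℂ y
  have hW : ∀ β : ℂ, 0 < β.im → ∀ x ∈ (complexEnd M).maxGenEigenspace β, y ⬝ᵥ x = 0 :=
    fun β hβ x hx => F.dotProduct_eq_zero_of_mem_W hvb
      ((le_iSup (fun β : {β : ℂ // 0 < β.im} => (complexEnd M).maxGenEigenspace β.1) ⟨β, hβ⟩) hx)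
  have hker : ∀ β : ℂ, (complexEnd M).maxGenEigenspace β ≤ LinearMap.ker ℓ := by
    intro β x hx
    rw [LinearMap.mem_ker]
    change y ⬝ᵥ x = 0
    rcases lt_trichotomy β.im 0 with hβ | hβ | hβ
    · have h := hW (star β) (by simpa using hβ) _ (star_mem_maxGenEigenspace M hx)
      have h2 := congrArg star h
      rw [← Matrix.star_dotProduct_star, star_star, hystar, star_zero, dotProduct_comm] at h2
      exact h2
    · obtain ⟨r, rfl⟩ : ∃ r : ℝ, (r : ℂ) = β := ⟨β.re, Complex.ext rfl (by simp [hβ])⟩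
      have hfin := finrank_maxGenEigenspace_ofReal M r
      rw [F.roots_charpoly hM, Multiset.count_singleton] at hfin
      split_ifs at hfin with hr
      -- Simplicity of `α` makes its generalized eigenspace the line through `a`.
      · subst hr
        let ac : Fin (2 * n + 1) → ℂ := fun i => (F.a i : ℂ)
        have hac : ac ∈ (complexEnd M).maxGenEigenspace (F.α : ℂ) := by
          refine (Module.End.genEigenspace (complexEnd M) (F.α : ℂ)).mono le_top
            (Module.End.mem_eigenspace_iff.2 ?_)
          ext i
          have := congrArg (Complex.ofReal) (congrFun F.eigen i)
          simpa [complexEnd, Matrix.mulVec, dotProduct, ac] using this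
        have hac0 : (⟨ac, hac⟩ : (complexEnd M).maxGenEigenspace (F.α : ℂ)) ≠ 0 := by
          intro h
          apply F.a_ne_zero
          ext i
          have := congrFun (congrArg Subtype.val h) i
          simpa [ac] using this
        obtain ⟨c, hc⟩ := (finrank_eq_one_iff_of_nonzero' _ hac0).1 hfin ⟨x, hx⟩
        have hc' : c • ac = x := congrArg Subtype.val hc
        have hyac : y ⬝ᵥ ac = 0 := by
          have := congrArg Complex.ofReal hva
          simpa [dotProduct, y, ac] using this
        rw [← hc', dotProduct_smul, hyac, smul_zero]
      · rw [Submodule.finrank_eq_zero] at hfin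
        rw [hfin, Submodule.mem_bot] at hx
        rw [hx, dotProduct_zero]
    · exact hW β hβ x hx
  have htop : LinearMap.ker ℓ = ⊤ := by
    rw [eq_top_iff, ← Module.End.iSup_maxGenEigenspace_eq_top (complexEnd M)]
    exact iSup_le hker
  ext i
  have : Pi.single i 1 ∈ LinearMap.ker ℓ := htop ▸ Submodule.mem_top
  rw [LinearMap.mem_ker] at this
  change y ⬝ᵥ Pi.single i 1 = 0 at this
  simpa [y] using this

/-- Translation of `ℍ × ℂⁿ` by a vector of `ℝ × ℂⁿ`. -/
def translation (n : ℕ) :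
    Multiplicative (ℝ × (Fin n → ℂ)) →* ((ℍ × (Fin n → ℂ)) ≃ₜ (ℍ × (Fin n → ℂ))) where
  toFun q :=
    { toFun := fun p => (q.toAdd.1 +ᵥ p.1, p.2 + q.toAdd.2)
      invFun := fun p => (-q.toAdd.1 +ᵥ p.1, p.2 - q.toAdd.2)
      left_inv := fun p => by
        ext1
        · exact neg_vadd_vadd _ _
        · simp
      right_inv := fun p => by
        ext1
        · exact vadd_neg_vadd _ _
        · simp
      continuous_toFun :=
        ((UpperHalfPlane.isometry_real_vadd _).continuous.comp continuous_fst).prodMk (by fun_prop)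
      continuous_invFun :=
        ((UpperHalfPlane.isometry_real_vadd _).continuous.comp continuous_fst).prodMk
          (by fun_prop) }
  map_one' := by
    ext1 p
    exact Prod.ext (zero_vadd _ _) (add_zero _)
  map_mul' q r := by
    ext1 p
    refine Prod.ext (add_vadd _ _ _) ?_
    change p.2 + (q.toAdd.2 + r.toAdd.2) = p.2 + r.toAdd.2 + q.toAdd.2
    rw [add_assoc, add_comm r.toAdd.2]

/-- The homomorphism from `ℤ^{2n+1}` to translations of `ℍ × ℂⁿ` with `e_i ↦ g_i`. -/
def latticeTranslation (F : Frame M) :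
    Multiplicative (Fin (2 * n + 1) → ℤ) →* ((ℍ × (Fin n → ℂ)) ≃ₜ (ℍ × (Fin n → ℂ))) :=
  (translation n).comp (AddMonoidHom.toMultiplicative
    (F.period.toAddMonoidHom.comp
      ((Int.castAddHom ℝ).compLeft (Fin (2 * n + 1)))))

theorem latticeTranslation_apply (F : Frame M) (v : Fin (2 * n + 1) → ℤ) (p : ℍ × (Fin n → ℂ)) :
    F.latticeTranslation (Multiplicative.ofAdd v) p =
      ((F.period fun i => (v i : ℝ)).1 +ᵥ p.1, p.2 + (F.period fun i => (v i : ℝ)).2) := rfl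

theorem latticeTranslation_single (F : Frame M) (i : Fin (2 * n + 1)) :
    F.latticeTranslation (Multiplicative.ofAdd (Pi.single i 1)) = F.g i := by
  have h : (fun j => ((Pi.single i 1 : Fin (2 * n + 1) → ℤ) j : ℝ)) = Pi.single i 1 := by
    ext j; simp [Pi.single_apply]
  have h' : (fun j => ((Pi.single i 1 : Fin (2 * n + 1) → ℝ) j : ℂ)) = Pi.single i 1 := by
    ext j; simp [Pi.single_apply, apply_ite]
  ext1 p
  rw [latticeTranslation_apply, h]
  refine Prod.ext ?_ ?_
  · change (Pi.single i 1 ⬝ᵥ F.a) +ᵥ p.1 = F.a i +ᵥ p.1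
    simp
  · funext j
    change p.2 j + (fun k => ((Pi.single i 1 : Fin (2 * n + 1) → ℝ) k : ℂ)) ⬝ᵥ
      (F.b j : Fin (2 * n + 1) → ℂ) = p.2 j + (F.b j : Fin (2 * n + 1) → ℂ) i
    rw [h']
    simp

/-- Move `M` across the dot product: `Mᵀv · a = v · Ma`, and likewise for each `b_j`. This is why
`g₀` involves `Rᵀ`. -/
theorem period_transpose_mulVec (F : Frame M) (v : Fin (2 * n + 1) → ℤ) :
    (F.period fun i => (((M : Matrix (Fin (2 * n + 1)) (Fin (2 * n + 1)) ℤ)ᵀ *ᵥ v) i : ℝ)) =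
      (F.α * (F.period fun i => (v i : ℝ)).1, F.Rᵀ *ᵥ (F.period fun i => (v i : ℝ)).2) := by
  have h1 : (fun i => (((M : Matrix (Fin (2 * n + 1)) (Fin (2 * n + 1)) ℤ)ᵀ *ᵥ v) i : ℝ)) =
      (fun i => (v i : ℝ)) ᵥ* realMatrix M := by
    ext i; simp [Matrix.mulVec, Matrix.vecMul, dotProduct, mul_comm]
  have h2 : (fun i => ((((M : Matrix (Fin (2 * n + 1)) (Fin (2 * n + 1)) ℤ)ᵀ *ᵥ v) i : ℝ) : ℂ)) =
      (fun i => ((v i : ℝ) : ℂ)) ᵥ* complexMatrix M := by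
    ext i; simp [Matrix.mulVec, Matrix.vecMul, dotProduct, mul_comm]
  refine Prod.ext ?_ (funext fun j => ?_)
  · change _ ⬝ᵥ F.a = F.α * (_ ⬝ᵥ F.a)
    rw [h1, ← Matrix.dotProduct_mulVec, F.eigen, dotProduct_smul, smul_eq_mul]
  · change _ ⬝ᵥ (F.b j : Fin (2 * n + 1) → ℂ) = _
    rw [h2, ← Matrix.dotProduct_mulVec, F.mulVec_b, dotProduct_sum]
    simp only [dotProduct_smul, smul_eq_mul]
    rfl

theorem g₀_conj_latticeTranslation (F : Frame M) (hM : IsTypeII M) (v : Fin (2 * n + 1) → ℤ) :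
    F.g₀ hM * F.latticeTranslation (Multiplicative.ofAdd v) * (F.g₀ hM)⁻¹ =
      F.latticeTranslation (Multiplicative.ofAdd
        ((M : Matrix (Fin (2 * n + 1)) (Fin (2 * n + 1)) ℤ)ᵀ *ᵥ v)) := by
  rw [mul_inv_eq_iff_eq_mul]
  ext1 p
  change F.g₀ hM (F.latticeTranslation _ p) = F.latticeTranslation _ (F.g₀ hM p)
  rw [latticeTranslation_apply, latticeTranslation_apply, period_transpose_mulVec]
  refine Prod.ext ?_ ?_
  · apply UpperHalfPlane.ext
    simp [g₀]
  · simp [g₀, Matrix.mulVec_add]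

theorem latticeTranslation_mem_group (F : Frame M) (hM : IsTypeII M)
    (v : Multiplicative (Fin (2 * n + 1) → ℤ)) : F.latticeTranslation v ∈ F.group hM := by
  have h : ∀ i, F.g i ∈ F.group hM := fun i =>
    Subgroup.subset_closure (Set.mem_insert_of_mem _ ⟨i, rfl⟩)
  have hv : v = ∏ i, Multiplicative.ofAdd (Pi.single i 1 : Fin (2 * n + 1) → ℤ) ^ (v.toAdd i) := by
    apply Multiplicative.toAdd.injective
    rw [toAdd_prod]
    ext j
    simp [Finset.sum_apply, Pi.single_apply]
  change v ∈ (F.group hM).comap F.latticeTranslation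
  rw [hv]
  refine Subgroup.prod_mem _ fun i _ => Subgroup.zpow_mem _ ?_ _
  rw [Subgroup.mem_comap, latticeTranslation_single]
  exact h i

/-- `g₀` normalizes the lattice of translations, so translations can be collected on the left of any
word. -/
theorem exists_eq_of_mem_group (F : Frame M) (hM : IsTypeII M)
    {f : (ℍ × (Fin n → ℂ)) ≃ₜ (ℍ × (Fin n → ℂ))} (hf : f ∈ F.group hM) :
    ∃ (v : Fin (2 * n + 1) → ℤ) (k : ℤ),
      f = F.latticeTranslation (Multiplicative.ofAdd v) * F.g₀ hM ^ k := by
  -- Moving `g₀⁻¹` past a translation needs `M⁻¹` to be integral.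
  have hinv : ∀ v : Fin (2 * n + 1) → ℤ, ∃ w : Fin (2 * n + 1) → ℤ,
      (F.g₀ hM)⁻¹ * F.latticeTranslation (Multiplicative.ofAdd v) =
        F.latticeTranslation (Multiplicative.ofAdd w) * (F.g₀ hM)⁻¹ := fun v => by
    refine ⟨((M⁻¹ : Matrix.SpecialLinearGroup (Fin (2 * n + 1)) ℤ) :
      Matrix (Fin (2 * n + 1)) (Fin (2 * n + 1)) ℤ)ᵀ *ᵥ v, ?_⟩
    have h := F.g₀_conj_latticeTranslation hM
      (((M⁻¹ : Matrix.SpecialLinearGroup (Fin (2 * n + 1)) ℤ) :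
        Matrix (Fin (2 * n + 1)) (Fin (2 * n + 1)) ℤ)ᵀ *ᵥ v)
    rw [Matrix.mulVec_mulVec, ← Matrix.transpose_mul, ← Matrix.SpecialLinearGroup.coe_mul,
      inv_mul_cancel, Matrix.SpecialLinearGroup.coe_one, Matrix.transpose_one,
      Matrix.one_mulVec] at h
    rw [← h]
    group
  have hg : ∀ v : Fin (2 * n + 1) → ℤ,
      F.g₀ hM * F.latticeTranslation (Multiplicative.ofAdd v) =
        F.latticeTranslation (Multiplicative.ofAdd
          ((M : Matrix (Fin (2 * n + 1)) (Fin (2 * n + 1)) ℤ)ᵀ *ᵥ v)) * F.g₀ hM := fun v =>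
    mul_inv_eq_iff_eq_mul.1 (F.g₀_conj_latticeTranslation hM v)
  induction hf using Subgroup.closure_induction_left with
  | one => exact ⟨0, 0, by simp⟩
  | mul_left x hx y hy ih =>
    obtain ⟨v, k, rfl⟩ := ih
    rcases hx with rfl | ⟨i, rfl⟩
    · exact ⟨_, 1 + k, by rw [← mul_assoc, hg, mul_assoc, zpow_one_add]⟩
    · refine ⟨Pi.single i 1 + v, k, ?_⟩
      rw [ofAdd_add, map_mul, latticeTranslation_single, mul_assoc]
  | inv_mul_cancel x hx y hy ih =>
    obtain ⟨v, k, rfl⟩ := ih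
    rcases hx with rfl | ⟨i, rfl⟩
    · obtain ⟨w, hw⟩ := hinv v
      refine ⟨w, -1 + k, ?_⟩
      rw [← mul_assoc, hw, mul_assoc, zpow_add, zpow_neg_one]
    · refine ⟨-Pi.single i 1 + v, k, ?_⟩
      rw [ofAdd_add, map_mul, ofAdd_neg, map_inv, latticeTranslation_single, mul_assoc]

/-! ### Freeness and discreteness of the action of `G_M` -/

theorem im_g₀_zpow (F : Frame M) (hM : IsTypeII M) (k : ℤ) (p : ℍ × (Fin n → ℂ)) :
    ((F.g₀ hM ^ k) p).1.im = F.α ^ k * p.1.im := by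
  have hα := (F.α_pos hM).ne'
  have h1 : ∀ p, (F.g₀ hM p).1.im = F.α * p.1.im := fun p => by
    simp [g₀]
  have h2 : ∀ p, ((F.g₀ hM)⁻¹ p).1.im = F.α⁻¹ * p.1.im := fun p => by
    have h := h1 ((F.g₀ hM)⁻¹ p)
    rw [show F.g₀ hM ((F.g₀ hM)⁻¹ p) = p from (F.g₀ hM).apply_symm_apply p] at h
    rw [h, inv_mul_cancel_left₀ hα]
  induction k using Int.induction_on generalizing p with
  | zero => simp
  | succ k ih =>
    rw [zpow_add_one, zpow_add_one₀ hα]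
    change ((F.g₀ hM ^ (k : ℤ)) (F.g₀ hM p)).1.im = _
    rw [ih, h1, mul_assoc]
  | pred k ih =>
    rw [zpow_sub_one, zpow_sub_one₀ hα]
    change ((F.g₀ hM ^ (-k : ℤ)) ((F.g₀ hM)⁻¹ p)).1.im = _
    rw [ih, h2, mul_assoc]

/-- An injective linear map on a finite-dimensional space is bounded below, and a nonzero integer
vector has sup norm at least `1`. -/
theorem exists_pos_forall_period_lt (F : Frame M) (hM : IsTypeII M) :
    ∃ ε > 0, ∀ v : Fin (2 * n + 1) → ℤ, ‖F.period fun i => (v i : ℝ)‖ < ε → v = 0 := by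
  obtain ⟨C, hC, h⟩ := F.period.injective_iff_antilipschitz.1 (F.period_injective hM)
  refine ⟨(C : ℝ)⁻¹, by positivity, fun v hv => ?_⟩
  have h1 : ‖fun i => (v i : ℝ)‖ ≤ C * ‖F.period fun i => (v i : ℝ)‖ := by
    simpa using h.le_mul_dist (fun i => (v i : ℝ)) 0
  have h2 : ‖fun i => (v i : ℝ)‖ < 1 := by
    refine h1.trans_lt ?_
    have : (0 : ℝ) < C := hC
    rwa [← lt_inv_mul_iff₀ this, mul_one]
  ext i
  have h3 := (norm_le_pi_norm (fun i => (v i : ℝ)) i).trans_lt h2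
  rw [Real.norm_eq_abs, ← Int.cast_abs] at h3
  exact Int.abs_lt_one_iff.1 (by exact_mod_cast h3)

theorem latticeTranslation_injective (F : Frame M) (hM : IsTypeII M) :
    Function.Injective F.latticeTranslation := by
  rw [injective_iff_map_eq_one]
  intro v hv
  obtain ⟨ε, hε, h⟩ := F.exists_pos_forall_period_lt hM
  have h1 := DFunLike.congr_fun hv ((UpperHalfPlane.I, 0) : ℍ × (Fin n → ℂ))
  rw [← ofAdd_toAdd v, latticeTranslation_apply] at h1
  have h2 : (F.period fun i => (v.toAdd i : ℝ)) = 0 := by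
    refine Prod.ext ?_ ?_
    · have := congrArg (fun q : ℍ × (Fin n → ℂ) => q.1.re) h1
      simpa using this
    · have := congrArg (fun q : ℍ × (Fin n → ℂ) => q.2) h1
      simpa using this
  exact Multiplicative.toAdd.injective (h _ (by rw [h2, norm_zero]; exact hε))

open Topology in
-- Translations preserve `Im w`, so `log (Im w)` moves by `k log α`, with `log α ≠ 0` because `α` is
-- irrational. A narrow window in this coordinate forces `k = 0`; the remaining translation is then
-- shorter than every nonzero period.
theorem exists_nhds_of_group (F : Frame M) (hM : IsTypeII M) (p₀ : ℍ × (Fin n → ℂ)) :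
    ∃ V ∈ 𝓝 p₀, ∀ f ∈ F.group hM, ∀ p ∈ V, f p ∈ V → f = 1 := by
  obtain ⟨ε, hε, hperiod⟩ := F.exists_pos_forall_period_lt hM
  have hα := F.α_pos hM
  have hlog : 0 < |Real.log F.α| :=
    abs_pos.2 (Real.log_ne_zero_of_pos_of_ne_one hα (F.irrational_α hM).ne_one)
  have c1 : Continuous fun p : ℍ × (Fin n → ℂ) => Real.log p.1.im :=
    (UpperHalfPlane.continuous_im.comp continuous_fst).log fun p => p.1.im_ne_zero
  have c2 : Continuous fun p : ℍ × (Fin n → ℂ) => p.1.re :=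
    UpperHalfPlane.continuous_re.comp continuous_fst
  -- Each radius is half the least nontrivial displacement: two points of the window differ by less
  -- than twice the radius.
  refine ⟨{p | dist (Real.log p.1.im) (Real.log p₀.1.im) < |Real.log F.α| / 2} ∩
    ({p | dist p.1.re p₀.1.re < ε / 2} ∩ {p | dist p.2 p₀.2 < ε / 2}), ?_, ?_⟩
  · refine IsOpen.mem_nhds (IsOpen.inter (isOpen_lt (c1.dist continuous_const) continuous_const)
      (IsOpen.inter (isOpen_lt (c2.dist continuous_const) continuous_const)
      (isOpen_lt (continuous_snd.dist continuous_const) continuous_const))) ?_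
    simp [hlog, hε]
  · rintro f hf p ⟨hp1, hp2, hp3⟩ ⟨hq1, hq2, hq3⟩
    obtain ⟨v, k, rfl⟩ := F.exists_eq_of_mem_group hM hf
    have him : ((F.latticeTranslation (Multiplicative.ofAdd v) * F.g₀ hM ^ k) p).1.im =
        F.α ^ k * p.1.im := by
      rw [← F.im_g₀_zpow hM]
      change (F.latticeTranslation _ ((F.g₀ hM ^ k) p)).1.im = _
      rw [latticeTranslation_apply]
      simp
    have hk : k = 0 := by
      have h1 := (dist_triangle_right _ _ _).trans_lt (add_lt_add hq1 hp1)
      rw [him, Real.log_mul (zpow_pos hα k).ne' p.1.im_ne_zero, Real.log_zpow, Real.dist_eq,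
        add_sub_cancel_right, add_halves, abs_mul, mul_lt_iff_lt_one_left hlog] at h1
      exact Int.abs_lt_one_iff.1 (by exact_mod_cast h1)
    subst hk
    rw [zpow_zero, mul_one] at hq2 hq3 ⊢
    rw [Set.mem_ofPred_eq, latticeTranslation_apply] at hq2 hq3
    have h2 := (dist_triangle_right _ _ _).trans_lt (add_lt_add hq2 hp2)
    have h3 := (dist_triangle_right _ _ _).trans_lt (add_lt_add hq3 hp3)
    have hv : v = 0 := by
      refine hperiod v (max_lt ?_ ?_)
      · simpa [Real.dist_eq] using h2
      · simpa [dist_eq_norm] using h3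
    rw [hv, ofAdd_zero, map_one]

end Frame

/-! ## The group of an Oeljeklaus–Toma manifold -/

theorem contractibleSpace_pi {ι : Type*} {Y : ι → Type*} [∀ i, TopologicalSpace (Y i)]
    [∀ i, ContractibleSpace (Y i)] : ContractibleSpace (∀ i, Y i) := by
  rw [contractible_iff_id_nullhomotopic]
  choose y hy using fun i => id_nullhomotopic (Y i)
  refine ⟨y, ⟨ContinuousMap.Homotopy.pi
    (f₀ := fun i => (⟨fun p : ∀ j, Y j => p i, continuous_apply i⟩ : C((∀ j, Y j), Y i)))
    (f₁ := fun i => ContinuousMap.const _ (y i)) fun i => ?_⟩⟩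
  exact (hy i).some.comp (ContinuousMap.Homotopy.refl ⟨fun p : ∀ j, Y j => p i, continuous_apply i⟩)

section OT

open NumberField Topology
open scoped Classical

variable {K : Type*} [Field K] [NumberField K]

/-- A nonzero algebraic integer has norm of absolute value at least `1`, so some archimedean
absolute value is at least `1`. This gives discreteness of `𝓞 K` in `ℝ^s × ℂ^t`. -/
theorem eq_zero_of_forall_infinitePlace_lt_one {ξ : 𝓞 K}
    (h : ∀ w : InfinitePlace K, w (ξ : K) < 1) : ξ = 0 := by
  by_contra h0
  obtain ⟨w⟩ : Nonempty (InfinitePlace K) := inferInstance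
  exact (h w).not_ge (InfinitePlace.one_le_of_lt_one h0 fun z _ => h z)

theorem otAction_apply (τ : ComplexPlace K → K →+* ℂ) (U : Subgroup (positiveUnits K))
    (g : Multiplicative (𝓞 K) ⋊[otMul U] U) (p : OTSpace K) :
    otAction τ U g p = otTranslation τ g.left.toAdd (otDilation τ (g.right : positiveUnits K) p) :=
  rfl

/-- `0` is isolated in the lattice of logarithms, and injectivity on `U` transfers this to `1`. -/
theorem exists_pos_forall_norm_logReal_lt {U : Subgroup (positiveUnits K)} (hU : IsAdmissible U) :
    ∃ ε > 0, ∀ u ∈ U, ‖logReal (Additive.ofMul u)‖ < ε → u = 1 := by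
  obtain ⟨ε, hε, h⟩ := Metric.exists_ball_inter_eq_singleton_of_mem_discrete
    (s := (logImage U : Set (RealPlace K → ℝ))) (isDiscrete_iff_discreteTopology.2 hU.discrete)
    (logImage U).zero_mem
  refine ⟨ε, hε, fun u hu hlt => hU.injOn u hu ?_⟩
  have : logReal (Additive.ofMul u) ∈ Metric.ball 0 ε ∩ (logImage U : Set (RealPlace K → ℝ)) :=
    ⟨by simpa using hlt, ⟨Additive.ofMul u, hu, rfl⟩⟩
  rw [h] at this
  exact this

/-- The vector `log (Im z_w)` is shifted by the logarithm vector of the unit part, so nearness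
forces that part to be `1`. The remaining translation by `ξ` has all archimedean absolute values
below `1`; `hτ` is what identifies `‖τ w ξ‖` with the absolute value at `w`. -/
theorem exists_nhds_of_otAction (τ : ComplexPlace K → K →+* ℂ)
    (hτ : ∀ w, InfinitePlace.mk (τ w) = w.1) {U : Subgroup (positiveUnits K)}
    (hU : IsAdmissible U) (p₀ : OTSpace K) :
    ∃ V ∈ 𝓝 p₀, ∀ g, ∀ p ∈ V, otAction τ U g p ∈ V → g = 1 := by
  obtain ⟨ε, hε, hlog⟩ := exists_pos_forall_norm_logReal_lt hU
  let L : OTSpace K → RealPlace K → ℝ := fun p w => Real.log (p.1 w).im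
  let R : OTSpace K → RealPlace K → ℝ := fun p w => (p.1 w).re
  have c1 : Continuous L := continuous_pi fun w =>
    (UpperHalfPlane.continuous_im.comp ((continuous_apply w).comp continuous_fst)).log
      fun p => (p.1 w).im_ne_zero
  have c2 : Continuous R := continuous_pi fun w =>
    UpperHalfPlane.continuous_re.comp ((continuous_apply w).comp continuous_fst)
  refine ⟨{p | dist (L p) (L p₀) < ε / 2} ∩
    ({p | dist (R p) (R p₀) < 1 / 2} ∩ {p | dist p.2 p₀.2 < 1 / 2}), ?_, ?_⟩
  · refine IsOpen.mem_nhds (IsOpen.inter (isOpen_lt (c1.dist continuous_const) continuous_const)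
      (IsOpen.inter (isOpen_lt (c2.dist continuous_const) continuous_const)
      (isOpen_lt (continuous_snd.dist continuous_const) continuous_const))) ?_
    simp [hε]
  · rintro g p ⟨hp1, hp2, hp3⟩ ⟨hq1, hq2, hq3⟩
    have hL : L (otAction τ U g p) =
        logReal (Additive.ofMul (g.right : positiveUnits K)) + L p := by
      funext w
      have hpos : 0 < realEmb w (((g.right : positiveUnits K) : (𝓞 K)ˣ) : 𝓞 K) :=
        (g.right : positiveUnits K).2 w
      have him : ((otAction τ U g p).1 w).im =
          realEmb w (((g.right : positiveUnits K) : (𝓞 K)ˣ) : 𝓞 K) * (p.1 w).im := by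
        rw [otAction_apply]
        simp [otTranslation, otDilation, posReal]
      change Real.log ((otAction τ U g p).1 w).im = _
      rw [him, Real.log_mul hpos.ne' (p.1 w).im_ne_zero]
      rfl
    have hright : g.right = 1 := by
      have h1 := (dist_triangle_right _ _ _).trans_lt (add_lt_add hq1 hp1)
      rw [hL, dist_eq_norm, add_sub_cancel_right, add_halves] at h1
      exact Subtype.ext (hlog _ g.right.2 h1)
    have hg : otAction τ U g p = otTranslation τ g.left.toAdd p := by
      have h1 : g = SemidirectProduct.inl g.left := SemidirectProduct.ext rfl hright
      conv_lhs => rw [h1, otAction, SemidirectProduct.lift_inl]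
      rfl
    rw [hg] at hq2 hq3
    have h2 := (dist_triangle_right _ _ _).trans_lt (add_lt_add hq2 hp2)
    have h3 := (dist_triangle_right _ _ _).trans_lt (add_lt_add hq3 hp3)
    rw [add_halves] at h2 h3
    have hleft : (g.left.toAdd : 𝓞 K) = 0 := by
      refine eq_zero_of_forall_infinitePlace_lt_one fun w => ?_
      rcases w.isReal_or_isComplex with hw | hw
      · have h4 := (dist_le_pi_dist _ _ (⟨w, hw⟩ : RealPlace K)).trans_lt h2
        rw [← InfinitePlace.norm_embedding_of_isReal hw]
        change ‖realEmb ⟨w, hw⟩ (g.left.toAdd : 𝓞 K)‖ < 1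
        simpa [R, otTranslation, Real.dist_eq] using h4
      · have h4 := (dist_le_pi_dist _ _ (⟨w, hw⟩ : ComplexPlace K)).trans_lt h3
        have h5 : w ((g.left.toAdd : 𝓞 K) : K) = ‖τ ⟨w, hw⟩ (g.left.toAdd : 𝓞 K)‖ := by
          rw [← InfinitePlace.apply, hτ]
        rw [h5]
        simpa [otTranslation, dist_eq_norm] using h4
    exact SemidirectProduct.ext hleft hright

theorem otAction_injective (τ : ComplexPlace K → K →+* ℂ)
    (hτ : ∀ w, InfinitePlace.mk (τ w) = w.1) {U : Subgroup (positiveUnits K)}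
    (hU : IsAdmissible U) : Function.Injective (otAction τ U) := by
  rw [injective_iff_map_eq_one]
  intro g hg
  obtain ⟨V, hV, h⟩ := exists_nhds_of_otAction τ hτ hU (fun _ => UpperHalfPlane.I, 0)
  refine h g _ (mem_of_mem_nhds hV) ?_
  rw [hg]
  exact mem_of_mem_nhds hV

theorem nonempty_fundamentalGroup_otManifold_mulEquiv (τ : ComplexPlace K → K →+* ℂ)
    (hτ : ∀ w, InfinitePlace.mk (τ w) = w.1) {U : Subgroup (positiveUnits K)}
    (hU : IsAdmissible U) (y : OTManifold τ U) :
    Nonempty (FundamentalGroup (OTManifold τ U) y ≃* Multiplicative (𝓞 K) ⋊[otMul U] U) := by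
  have : ContractibleSpace (RealPlace K → ℍ) := contractibleSpace_pi
  have hq := isQuotientCoveringMap_orbitSpace (otAction τ U).range fun p₀ => by
    obtain ⟨V, hV, h⟩ := exists_nhds_of_otAction τ hτ hU p₀
    refine ⟨V, hV, ?_⟩
    rintro _ ⟨g, rfl⟩ p hp hgp
    rw [h g p hp hgp, map_one]
  obtain ⟨e⟩ := nonempty_fundamentalGroup_mulEquiv hq y
  exact ⟨e.trans (MonoidHom.ofInjective (otAction_injective τ hτ hU)).symm⟩

end OT

/-- The algebraic core, with `A = Mᵀ` and `g = g₀`; only the injectivity of the isomorphism matters.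
-/
theorem isEmpty_group_mulEquiv {n : ℕ} {M : Matrix.SpecialLinearGroup (Fin (2 * n + 1)) ℤ}
    (hM : IsTypeII M) (hdiag : ¬ IsDiagonalizable M) (F : Frame M)
    {K : Type*} [Field K] [NumberField K] (U : Subgroup (positiveUnits K)) :
    IsEmpty (F.group hM ≃* Multiplicative (𝓞 K) ⋊[otMul U] U) := by
  refine ⟨fun e => hdiag ?_⟩
  have hg₀ : F.g₀ hM ∈ F.group hM := Subgroup.subset_closure (Set.mem_insert _ _)
  obtain ⟨u, hu⟩ := exists_aeval_minpoly_eq_zero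
    (F.latticeTranslation.codRestrict (F.group hM) (F.latticeTranslation_mem_group hM))
    (fun v w h => F.latticeTranslation_injective hM (congrArg Subtype.val h))
    (⟨F.g₀ hM, hg₀⟩ : F.group hM) _ (F.det_transpose_sub_one_ne_zero hM)
    (fun v => Subtype.ext (F.g₀_conj_latticeTranslation hM v)) e.toMonoidHom e.injective
  exact isDiagonalizable_of_aeval_transpose M _ (separable_minpoly_map u) hu

end GenInoue

end

theorem proposition5p3 (n : ℕ) (M : Matrix.SpecialLinearGroup (Fin (2 * n + 1)) ℤ)
    (hM : GenInoue.IsTypeII M) (hdiag : ¬ GenInoue.IsDiagonalizable M)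
    (F : GenInoue.Frame M)
    (K : Type*) [Field K] [NumberField K]
    (τ : GenInoue.ComplexPlace K → K →+* ℂ)
    (hτ : ∀ w, NumberField.InfinitePlace.mk (τ w) = w.1)
    (U : Subgroup (GenInoue.positiveUnits K)) (hU : GenInoue.IsAdmissible U) :
    (∀ (x : F.T hM) (y : GenInoue.OTManifold τ U),
      IsEmpty (FundamentalGroup (F.T hM) x ≃* FundamentalGroup (GenInoue.OTManifold τ U) y)) ∧
    IsEmpty (F.T hM ≃ₜ GenInoue.OTManifold τ U) := by
  have hq := GenInoue.isQuotientCoveringMap_orbitSpace (F.group hM) (F.exists_nhds_of_group hM)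
  have hE := GenInoue.isEmpty_group_mulEquiv hM hdiag F U
  refine ⟨fun x y => ⟨fun e => ?_⟩, ⟨fun e => ?_⟩⟩
  · obtain ⟨e₁⟩ := GenInoue.nonempty_fundamentalGroup_mulEquiv hq x
    obtain ⟨e₂⟩ := GenInoue.nonempty_fundamentalGroup_otManifold_mulEquiv τ hτ hU y
    exact hE.false (e₁.symm.trans (e.trans e₂))
  · have y : GenInoue.OTManifold τ U :=
      Quotient.mk _ ((fun _ => UpperHalfPlane.I, 0) : GenInoue.OTSpace K)
    -- Composing with the homeomorphism makes `ℍ × ℂⁿ` a covering of the Oeljeklaus–Toma manifold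
    -- with group `G_M`, so both computations use the same base point `y`.
    obtain ⟨e₁⟩ := GenInoue.nonempty_fundamentalGroup_mulEquiv (hq.homeomorph_comp e) y
    obtain ⟨e₂⟩ := GenInoue.nonempty_fundamentalGroup_otManifold_mulEquiv τ hτ hU y
    exact hE.false (e₁.symm.trans e₂)
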